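/- For $\kappa\in\mathbb{C}$ let $E_\kappa(z)=e^z+\kappa$, and let $F(E_\kappa)$ denote the Fatou set of $E_\kappa$, that is, the set of all points having an open neighbourhood on which the iterates of $E_\kappa$ form a normal family (as maps into the Riemann sphere). Suppose that $E_\kappa$ has an attracting cycle of exact period $n>1$ with multiplier $\mu$ (so $|\mu|<1$). Let $a_0$ be the point of the cycle for which the component $A_0$ of $F(E_\kappa)$ containing $a_0$ (an immediate attracting basin) contains a left half-plane $\{z:\operatorname{Re} z<R\}$. Let $\kappa_0\in\mathbb{C}$ be such that $E_{\kappa_0}$ has a fixed point with the same multiplier $\mu$, and let $\Psi: A_0\to F(E_{\kappa_0})$ be a conformal isomorphism which conjugates $E_\kappa^n|_{A_0}$ to $E_{\kappa_0}|_{F(E_{\kappa_0})}$, i.e. $\Psi\circ E_\kappa^n=E_{\kappa_0}\circ\Psi$ on $A_0$. Then $\Psi$ has no continuous extension to $\partial A_0$: there is no continuous map $\Phi:\overline{A_0}\to\mathbb{C}$ with $\Phi|_{A_0}=\Psi$. -/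

import Mathlib

open Filter Topology

/-- The exponential map with parameter `κ`, that is `z ↦ exp z + κ`. -/
noncomputable def expMap (κ : ℂ) (z : ℂ) : ℂ := Complex.exp z + κ

/-- A sequence of functions tends to `∞` locally uniformly on `U`
(uniformly on every compact subset of `U`). -/
def TendstoInftyLocallyUniformlyOn (f : ℕ → ℂ → ℂ) (U : Set ℂ) : Prop :=
  ∀ K ⊆ U, IsCompact K → ∀ M : ℝ, ∀ᶠ k in atTop, ∀ z ∈ K, M < ‖f k z‖

/-- The iterates of `f` form a normal family on `U`: every sequence of iterates has a subsequence
that converges locally uniformly on `U`, either to a finite function or to `∞`. -/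
def IteratesNormalOn (f : ℂ → ℂ) (U : Set ℂ) : Prop :=
  ∀ u : ℕ → ℕ, ∃ φ : ℕ → ℕ, StrictMono φ ∧
    ((∃ g : ℂ → ℂ, TendstoLocallyUniformlyOn (fun k => f^[u (φ k)]) g atTop U) ∨
      TendstoInftyLocallyUniformlyOn (fun k => f^[u (φ k)]) U)

/-- The Fatou set of an entire function: the points with an open neighbourhood
on which the iterates form a normal family. -/
def fatouSet (f : ℂ → ℂ) : Set ℂ :=
  {z | ∃ U : Set ℂ, IsOpen U ∧ z ∈ U ∧ IteratesNormalOn f U}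

/-- The multiplier of a point of period `n`. -/
noncomputable def multiplier (f : ℂ → ℂ) (n : ℕ) (a : ℂ) : ℂ := deriv f^[n] a

/-- `a` lies on an attracting cycle of `f` of exact period `n` (with `n ≥ 1`). -/
def IsAttractingPeriodicPt (f : ℂ → ℂ) (n : ℕ) (a : ℂ) : Prop :=
  0 < n ∧ Function.minimalPeriod f a = n ∧ ‖multiplier f n a‖ < 1

/-- The immediate basin of a point `a` of an attracting cycle of `f`:
the connected component of the Fatou set that contains `a`. -/
def immediateBasin (f : ℂ → ℂ) (a : ℂ) : Set ℂ := connectedComponentIn (fatouSet f) a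

/-- `Ψ`, restricted to `A`, is a conformal isomorphism from `A` onto `B` that conjugates
`f` on `A` to `g` on `B`. The inverse of a holomorphic bijection between open sets is
automatically holomorphic. -/
def IsConformalConjugacy (Ψ f g : ℂ → ℂ) (A B : Set ℂ) : Prop :=
  DifferentiableOn ℂ Ψ A ∧ Set.BijOn Ψ A B ∧ ∀ z ∈ A, Ψ (f z) = g (Ψ z)

/-! Write `f` for `expMap κ` and `A` for the immediate basin. The return map `f^[n]` involves at
least two exponentials, its model `expMap κ₀` only one. An extendable conjugacy cannot absorb this
difference in growth.

Since `A` contains a left half-plane, it is invariant under translation by `2πi`. Both maps factor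
through `exp` and `Ψ` is injective, so `Ψ (z + 2πik) = Ψ z + k * c` with `‖c‖ ≥ 2π`: along vertical
translates `Ψ` grows at least linearly (`exists_translation_of_conjugacy`).

Conversely, a point `ζ` high up in `A` has a preimage in `A` under `f^[n]` of size about `log (log
‖ζ‖)` (`exists_preimage_norm_le`). For this, the images `f^[j] '' A` with `0 < j < n` must have
bounded imaginary part. They are connected and disjoint from `A`, while `A` contains a curve from
`-∞` to `+∞` in a horizontal strip together with all its `2πi`-translates, so they are trapped
between two translates (`exists_abs_im_iterate_le`).

A continuous extension would bound `Ψ` by some `P` on the part of `A` in a fixed disc. With `G t =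
exp t + ‖κ₀‖`, pulling `ζ` of size about `G^[2 * N] t₀` back `N` times into that disc gives `‖Ψ ζ‖ ≤
G^[N] P`, far less than linear growth demands. -/

/-! ### Normality and invariance of the Fatou set -/

section FatouSet

variable {f : ℂ → ℂ} {U V : Set ℂ}

theorem isOpen_fatouSet (f : ℂ → ℂ) : IsOpen (fatouSet f) := by
  rw [isOpen_iff_mem_nhds]
  rintro z ⟨U, hU, hz, hN⟩
  filter_upwards [hU.mem_nhds hz] with w hw using ⟨U, hU, hw, hN⟩

/-- For normality it suffices to consider sequences of iterates of positive order. -/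
theorem IteratesNormalOn.of_pos
    (h : ∀ u : ℕ → ℕ, (∀ k, 0 < u k) → ∃ φ : ℕ → ℕ, StrictMono φ ∧
      ((∃ g : ℂ → ℂ, TendstoLocallyUniformlyOn (fun k => f^[u (φ k)]) g atTop U) ∨
        TendstoInftyLocallyUniformlyOn (fun k => f^[u (φ k)]) U)) :
    IteratesNormalOn f U := by
  intro u
  by_cases hu : ∃ᶠ k in atTop, u k = 0
  · obtain ⟨φ, hφ, h0⟩ := extraction_of_frequently_atTop hu
    refine ⟨φ, hφ, Or.inl ⟨id, ?_⟩⟩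
    simp only [h0, Function.iterate_zero]
    intro s hs x _
    exact ⟨Set.univ, univ_mem, Eventually.of_forall fun k y _ => refl_mem_uniformity hs⟩
  · obtain ⟨N, hN⟩ := eventually_atTop.1 (not_frequently.1 hu)
    obtain ⟨φ, hφ, H⟩ := h (fun k => u (k + N))
      (fun k => Nat.pos_of_ne_zero (hN (k + N) (Nat.le_add_left _ _)))
    exact ⟨fun k => φ k + N, fun i j hij => Nat.add_lt_add_right (hφ hij) N, H⟩

theorem TendstoInftyLocallyUniformlyOn.comp {F : ℕ → ℂ → ℂ} {s : ℂ → ℂ}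
    (h : TendstoInftyLocallyUniformlyOn F U) (hs : ContinuousOn s V) (hm : Set.MapsTo s V U) :
    TendstoInftyLocallyUniformlyOn (fun k => F k ∘ s) V := by
  intro K hK hKc M
  filter_upwards [h (s '' K) (Set.image_subset_iff.2 fun z hz => hm (hK hz))
    (hKc.image_of_continuousOn (hs.mono hK)) M] with k hk z hz
  exact hk (s z) (Set.mem_image_of_mem s hz)

theorem TendstoInftyLocallyUniformlyOn.congr {F G : ℕ → ℂ → ℂ}
    (h : TendstoInftyLocallyUniformlyOn F U) (hFG : ∀ k, Set.EqOn (F k) (G k) U) :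
    TendstoInftyLocallyUniformlyOn G U := by
  intro K hK hKc M
  filter_upwards [h K hK hKc M] with k hk z hz
  rw [← hFG k (hK hz)]
  exact hk z hz

/-- Since `f^[m + 1] ∘ s = f^[m]` on `V`, a subsequence chosen for the shifted orders `u k + 1` on
`U` serves for the orders `u k` on `V`. -/
theorem IteratesNormalOn.of_section (h : IteratesNormalOn f U) {s : ℂ → ℂ}
    (hs : ContinuousOn s V) (hm : Set.MapsTo s V U) (hfs : ∀ w ∈ V, f (s w) = w) :
    IteratesNormalOn f V := by
  intro u
  obtain ⟨φ, hφ, H⟩ := h (fun k => u k + 1)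
  have key : ∀ k, Set.EqOn (f^[u (φ k) + 1] ∘ s) (f^[u (φ k)]) V := fun k w hw => by
    simp [hfs w hw]
  refine ⟨φ, hφ, H.imp ?_ ?_⟩
  · rintro ⟨g, hg⟩
    exact ⟨g ∘ s, (hg.comp s hm hs).congr key⟩
  · exact fun hinf => (hinf.comp hs hm).congr key

theorem IteratesNormalOn.preimage (h : IteratesNormalOn f U) (hf : Continuous f) :
    IteratesNormalOn f (f ⁻¹' U) := by
  refine .of_pos fun u hu => ?_
  obtain ⟨φ, hφ, H⟩ := h (fun k => u k - 1)
  have key : ∀ k, Set.EqOn (f^[u (φ k) - 1] ∘ f) (f^[u (φ k)]) (f ⁻¹' U) := fun k w _ => by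
    obtain ⟨m, hm⟩ := Nat.exists_eq_succ_of_ne_zero (hu (φ k)).ne'
    simp [hm, Function.iterate_succ_apply]
  refine ⟨φ, hφ, H.imp ?_ ?_⟩
  · rintro ⟨g, hg⟩
    exact ⟨g ∘ f, (hg.comp f (fun z hz => hz) hf.continuousOn).congr key⟩
  · exact fun hinf => (hinf.comp hf.continuousOn (fun z hz => hz)).congr key

theorem mem_fatouSet_of_apply_mem (hf : Continuous f) {z : ℂ} (h : f z ∈ fatouSet f) :
    z ∈ fatouSet f := by
  obtain ⟨U, hU, hz, hN⟩ := h
  exact ⟨f ⁻¹' U, hU.preimage hf, hz, hN.preimage hf⟩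

theorem mem_fatouSet_of_iterate_mem (hf : Continuous f) {z : ℂ} (k : ℕ)
    (h : f^[k] z ∈ fatouSet f) : z ∈ fatouSet f := by
  induction k generalizing z with
  | zero => exact h
  | succ k ih => exact mem_fatouSet_of_apply_mem hf (ih (by simpa using h))

end FatouSet

/-! ### Periodicity of the exponential map and its immediate basins -/

section ExpMap

variable {κ : ℂ}

theorem differentiable_expMap (κ : ℂ) : Differentiable ℂ (expMap κ) := by
  unfold expMap; fun_prop

theorem continuous_expMap (κ : ℂ) : Continuous (expMap κ) := (differentiable_expMap κ).continuous

theorem differentiable_iterate_expMap (κ : ℂ) (k : ℕ) : Differentiable ℂ (expMap κ)^[k] :=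
  (differentiable_expMap κ).iterate k

theorem expMap_add_two_pi_mul_int (κ z : ℂ) (k : ℤ) :
    expMap κ (z + 2 * Real.pi * Complex.I * k) = expMap κ z := by
  have := Complex.exp_periodic.int_mul k z
  rw [expMap, expMap, ← this]
  ring_nf

theorem iterate_expMap_add_two_pi_mul_int (κ z : ℂ) (k : ℤ) {n : ℕ} (hn : 0 < n) :
    (expMap κ)^[n] (z + 2 * Real.pi * Complex.I * k) = (expMap κ)^[n] z := by
  obtain ⟨m, rfl⟩ := Nat.exists_eq_succ_of_ne_zero hn.ne'
  simp [Function.iterate_succ_apply, expMap_add_two_pi_mul_int]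

/-- The branch `s` of the inverse with `s (expMap κ z) = z` is continuous near `expMap κ z`, so
normality is carried forward by `IteratesNormalOn.of_section`. -/
theorem expMap_mem_fatouSet {z : ℂ} (h : z ∈ fatouSet (expMap κ)) :
    expMap κ z ∈ fatouSet (expMap κ) := by
  obtain ⟨U, hU, hz, hN⟩ := h
  set s : ℂ → ℂ := fun w => z + Complex.log ((w - κ) / Complex.exp z) with hs
  have hs0 : s (expMap κ z) = z := by simp [hs, expMap, Complex.exp_ne_zero]
  set W : Set ℂ := {w | (w - κ) / Complex.exp z ∈ Complex.slitPlane} with hW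
  have hWo : IsOpen W := Complex.isOpen_slitPlane.preimage (by fun_prop)
  have hsW : ContinuousOn s W := by
    refine continuousOn_const.add (ContinuousOn.clog (by fun_prop) fun w hw => hw)
  have hzW : expMap κ z ∈ W := by simp [hW, expMap, Complex.exp_ne_zero]
  refine ⟨W ∩ s ⁻¹' U, hsW.isOpen_inter_preimage hWo hU, ⟨hzW, ?_⟩,
    hN.of_section (s := s) (hsW.mono Set.inter_subset_left) (fun w hw => hw.2) ?_⟩
  · change s _ ∈ U
    rwa [hs0]
  · rintro w ⟨hw, -⟩
    simp only [expMap, hs]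
    rw [Complex.exp_add, Complex.exp_log (Complex.slitPlane_ne_zero hw),
      mul_div_cancel₀ _ (Complex.exp_ne_zero z)]
    ring

theorem iterate_expMap_mem_fatouSet {z : ℂ} (h : z ∈ fatouSet (expMap κ)) (k : ℕ) :
    (expMap κ)^[k] z ∈ fatouSet (expMap κ) := by
  induction k with
  | zero => exact h
  | succ k ih => rw [Function.iterate_succ_apply']; exact expMap_mem_fatouSet ih

theorem add_two_pi_mul_int_mem_fatouSet {z : ℂ} (h : z ∈ fatouSet (expMap κ)) (k : ℤ) :
    z + 2 * Real.pi * Complex.I * k ∈ fatouSet (expMap κ) := by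
  refine mem_fatouSet_of_apply_mem (continuous_expMap κ) ?_
  rw [expMap_add_two_pi_mul_int]
  exact expMap_mem_fatouSet h

variable {a : ℂ}

theorem isOpen_immediateBasin (f : ℂ → ℂ) (a : ℂ) : IsOpen (immediateBasin f a) :=
  (isOpen_fatouSet f).connectedComponentIn

theorem immediateBasin_subset_fatouSet (f : ℂ → ℂ) (a : ℂ) : immediateBasin f a ⊆ fatouSet f :=
  connectedComponentIn_subset _ _

theorem isPreconnected_immediateBasin (f : ℂ → ℂ) (a : ℂ) :
    IsPreconnected (immediateBasin f a) := isPreconnected_connectedComponentIn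

theorem mem_immediateBasin_self {f : ℂ → ℂ} (h : (immediateBasin f a).Nonempty) :
    a ∈ immediateBasin f a :=
  mem_connectedComponentIn (connectedComponentIn_nonempty_iff.1 h)

/-- A preconnected subset of the Fatou set that meets an immediate basin is contained in it. -/
theorem IsPreconnected.subset_immediateBasin {f : ℂ → ℂ} {S : Set ℂ} (hS : IsPreconnected S)
    (hSF : S ⊆ fatouSet f) {z : ℂ} (hz : z ∈ S) (hzA : z ∈ immediateBasin f a) :
    S ⊆ immediateBasin f a := by
  have := hS.subset_connectedComponentIn hz hSF
  rwa [immediateBasin, connectedComponentIn_eq hzA]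

/-- The translated basin is connected, lies in the Fatou set, and meets the original basin because
the left half-plane is mapped to itself. -/
theorem add_two_pi_mul_int_mem_immediateBasin {R : ℝ}
    (hR : {z : ℂ | z.re < R} ⊆ immediateBasin (expMap κ) a) {z : ℂ}
    (hz : z ∈ immediateBasin (expMap κ) a) (k : ℤ) :
    z + 2 * Real.pi * Complex.I * k ∈ immediateBasin (expMap κ) a := by
  set c : ℂ := 2 * Real.pi * Complex.I * k with hc
  have hre : c.re = 0 := by simp [hc]
  refine ((isPreconnected_immediateBasin (expMap κ) a).image (· + c)
    (by fun_prop)).subset_immediateBasin ?_ (z := ((R - 1 : ℝ) : ℂ) + c) ?_ ?_ ⟨z, hz, rfl⟩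
  · rintro _ ⟨w, hw, rfl⟩
    exact add_two_pi_mul_int_mem_fatouSet (immediateBasin_subset_fatouSet _ _ hw) k
  · exact ⟨_, hR (by simp), rfl⟩
  · exact hR (by simp [hre])

theorem mapsTo_iterate_immediateBasin {n : ℕ} (hper : (expMap κ)^[n] a = a) :
    Set.MapsTo (expMap κ)^[n] (immediateBasin (expMap κ) a) (immediateBasin (expMap κ) a) := by
  intro z hz
  have ha := mem_immediateBasin_self ⟨z, hz⟩
  refine ((isPreconnected_immediateBasin (expMap κ) a).image _
    (differentiable_iterate_expMap κ n).continuous.continuousOn).subset_immediateBasin ?_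
    (z := a) ⟨a, ha, hper⟩ ha ⟨z, hz, rfl⟩
  rintro _ ⟨w, hw, rfl⟩
  exact iterate_expMap_mem_fatouSet (immediateBasin_subset_fatouSet _ _ hw) n

/-- Near an attracting fixed point all orbits converge to it. -/
theorem eventually_tendsto_iterate_of_norm_deriv_lt_one {g : ℂ → ℂ} (hg : DifferentiableAt ℂ g a)
    (hfix : g a = a) (hd : ‖deriv g a‖ < 1) :
    ∀ᶠ z in 𝓝 a, Tendsto (fun k => g^[k] z) atTop (𝓝 a) := by
  obtain ⟨q, hq, hq1⟩ := exists_between hd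
  have hq0 : 0 ≤ q := (norm_nonneg _).trans hq.le
  have h1 : ∀ᶠ z in 𝓝 a, ‖g z - a‖ ≤ q * ‖z - a‖ := by
    have := hg.hasDerivAt.isLittleO.def (sub_pos.2 hq)
    filter_upwards [this] with z hz
    rw [hfix] at hz
    calc ‖g z - a‖ = ‖(g z - a - (z - a) • deriv g a) + (z - a) • deriv g a‖ := by ring_nf
      _ ≤ (q - ‖deriv g a‖) * ‖z - a‖ + ‖z - a‖ * ‖deriv g a‖ := by
          refine (norm_add_le _ _).trans (add_le_add hz ?_)
          rw [norm_smul]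
      _ = q * ‖z - a‖ := by ring
  obtain ⟨ε, hε, hball⟩ := Metric.eventually_nhds_iff_ball.1 h1
  filter_upwards [Metric.ball_mem_nhds a hε] with z hz
  have key : ∀ k, ‖g^[k] z - a‖ ≤ q ^ k * ‖z - a‖ := by
    intro k
    induction k with
    | zero => simp
    | succ k ih =>
      rw [Function.iterate_succ_apply']
      have hin : g^[k] z ∈ Metric.ball a ε := by
        rw [mem_ball_iff_norm] at hz ⊢
        refine lt_of_le_of_lt (ih.trans ?_) hz
        exact mul_le_of_le_one_left (norm_nonneg _) (pow_le_one₀ hq0 hq1.le)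
      calc _ ≤ q * ‖g^[k] z - a‖ := hball _ hin
        _ ≤ q * (q ^ k * ‖z - a‖) := by gcongr
        _ = _ := by ring
  rw [tendsto_iff_norm_sub_tendsto_zero]
  refine squeeze_zero (fun _ => norm_nonneg _) key ?_
  simpa using (tendsto_pow_atTop_nhds_zero_of_lt_one hq0 hq1).mul_const ‖z - a‖

/-- If the orbits of an open set under `f^[n]` converge to `a`, then by normality so do those of
all nearby points. -/
theorem tendsto_iterate_of_iteratesNormalOn_ball {f : ℂ → ℂ} (hf : Differentiable ℂ f) {n : ℕ}
    {z₀ z : ℂ} {r : ℝ} (hN : IteratesNormalOn f (Metric.ball z₀ r))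
    {y : ℂ} (hy : y ∈ Metric.ball z₀ r)
    (hya : ∀ᶠ w in 𝓝 y, Tendsto (fun k => (f^[n])^[k] w) atTop (𝓝 a))
    (hz : z ∈ Metric.ball z₀ r) : Tendsto (fun k => (f^[n])^[k] z) atTop (𝓝 a) := by
  refine tendsto_of_subseq_tendsto fun u hu => ?_
  obtain ⟨φ, hφ, H⟩ := hN (fun k => n * u k)
  simp only [Function.iterate_mul] at H
  have hlim : ∀ᶠ w in 𝓝 y, Tendsto (fun k => (f^[n])^[u (φ k)] w) atTop (𝓝 a) := by
    filter_upwards [hya] with w hw using hw.comp (hu.comp hφ.tendsto_atTop)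
  refine ⟨φ, ?_⟩
  rcases H with ⟨g, hg⟩ | hinf
  · have hgd : DifferentiableOn ℂ g (Metric.ball z₀ r) :=
      hg.differentiableOn (Eventually.of_forall fun k =>
        ((hf.iterate n).iterate _).differentiableOn) Metric.isOpen_ball
    -- The limit is the constant `a` near `y`; the identity theorem spreads this over the ball.
    have heq : g =ᶠ[𝓝 y] fun _ => a := by
      filter_upwards [hlim, Metric.isOpen_ball.mem_nhds hy] with w hw hwB
      exact tendsto_nhds_unique (hg.tendsto_at hwB) hw
    have := (hgd.analyticOnNhd Metric.isOpen_ball).eqOn_of_preconnected_of_eventuallyEq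
      analyticOnNhd_const (convex_ball z₀ r).isPreconnected hy heq hz
    exact (show g z = a from this) ▸ hg.tendsto_at hz
  · exfalso
    have h1 := hinf {y} (Set.singleton_subset_iff.2 hy) isCompact_singleton (‖a‖ + 1)
    have h2 := hlim.self_of_nhds.norm.eventually (gt_mem_nhds (lt_add_one ‖a‖))
    obtain ⟨k, hk1, hk2⟩ := (h1.and h2).exists
    exact absurd (hk1 y rfl) (not_lt.2 hk2.le)

theorem tendsto_iterate_of_mem_immediateBasin {f : ℂ → ℂ} (hf : Differentiable ℂ f) {n : ℕ}
    (hper : f^[n] a = a) (hmul : ‖multiplier f n a‖ < 1) {z : ℂ}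
    (hz : z ∈ immediateBasin f a) : Tendsto (fun k => (f^[n])^[k] z) atTop (𝓝 a) := by
  set S : Set ℂ := {z | ∀ᶠ w in 𝓝 z, Tendsto (fun k => (f^[n])^[k] w) atTop (𝓝 a)} with hS
  have hSo : IsOpen S := isOpen_setOfPred_eventually_nhds
  have haS : a ∈ S :=
    eventually_tendsto_iterate_of_norm_deriv_lt_one (hf.iterate n a) hper hmul
  -- `S` is open; normality shows that it is also closed relative to the connected basin.
  have hsub : immediateBasin f a ⊆ S := by
    refine (isPreconnected_immediateBasin f a).subset_of_closure_inter_subset hSo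
      ⟨a, mem_immediateBasin_self ⟨z, hz⟩, haS⟩ ?_
    rintro x ⟨hxS, hxA⟩
    obtain ⟨U, hU, hxU, hN⟩ := immediateBasin_subset_fatouSet f a hxA
    obtain ⟨r, hr, hrU⟩ := Metric.isOpen_iff.1 hU x hxU
    have hNB : IteratesNormalOn f (Metric.ball x r) := by
      refine fun u => (hN u).imp fun φ hφ => ⟨hφ.1, hφ.2.imp ?_ ?_⟩
      · exact fun ⟨g, hg⟩ => ⟨g, hg.mono hrU⟩
      · exact fun h K hK => h K (hK.trans hrU)
    obtain ⟨y, hyB, hyS⟩ :=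
      mem_closure_iff.1 hxS _ Metric.isOpen_ball (Metric.mem_ball_self hr)
    filter_upwards [Metric.ball_mem_nhds x hr] with w hw
    exact tendsto_iterate_of_iteratesNormalOn_ball hf hNB hyB hyS hw
  exact (hsub hz).self_of_nhds

/-- The forward images of an immediate basin of an attracting cycle of exact period `n` do not
return to the basin before time `n`. -/
theorem iterate_notMem_immediateBasin {f : ℂ → ℂ} (hf : Differentiable ℂ f) {n : ℕ}
    (ha : IsAttractingPeriodicPt f n a) {j : ℕ} (hj : 0 < j) (hjn : j < n) {z : ℂ}
    (hz : z ∈ immediateBasin f a) : f^[j] z ∉ immediateBasin f a := by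
  obtain ⟨-, hmin, hmul⟩ := ha
  have hper : f^[n] a = a := hmin ▸ Function.iterate_minimalPeriod
  intro hjz
  have h1 := tendsto_iterate_of_mem_immediateBasin hf hper hmul hjz
  have h2 := ((hf.iterate j).continuous.tendsto a).comp
    (tendsto_iterate_of_mem_immediateBasin hf hper hmul hz)
  have h3 : (fun k => (f^[n])^[k] (f^[j] z)) = f^[j] ∘ fun k => (f^[n])^[k] z := by
    funext k
    simp only [Function.comp, ← Function.iterate_mul, ← Function.iterate_add_apply, add_comm]
  rw [h3] at h1
  -- The return orbit of `f^[j] z` converges both to `a` and to `f^[j] a`.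
  have h4 : Function.IsPeriodicPt f j a := tendsto_nhds_unique h2 h1
  exact absurd (h4.minimalPeriod_le hj) (by omega)

end ExpMap

/-! ### Continuous logarithms and crossing curves -/

/-- A continuous function on a preconnected set with values in `c + 2πiℤ` is constant. -/
theorem IsPreconnected.eqOn_of_exp_eq {X : Type*} [TopologicalSpace X] {S : Set X}
    (hS : IsPreconnected S) {θ : X → ℂ} (hθ : ContinuousOn θ S) {c : ℂ}
    (h : ∀ x ∈ S, Complex.exp (θ x) = c) {x y : X} (hx : x ∈ S) (hy : y ∈ S) : θ x = θ y := by
  have key : ∀ z ∈ S, ∃ k : ℤ, θ z = θ x + k * (2 * Real.pi * Complex.I) := fun z hz =>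
    Complex.exp_eq_exp_iff_exists_int.1 ((h z hz).trans (h x hx).symm)
  have him : ContinuousOn (fun z => (θ z).im / (2 * Real.pi) - (θ x).im / (2 * Real.pi)) S :=
    ((Complex.continuous_im.comp_continuousOn hθ).div_const _).sub continuousOn_const
  have hT : Set.MapsTo (fun z => (θ z).im / (2 * Real.pi) - (θ x).im / (2 * Real.pi)) S
      (Set.range ((↑) : ℤ → ℝ)) := by
    intro z hz
    obtain ⟨k, hk⟩ := key z hz
    refine ⟨k, ?_⟩
    simp only [hk]
    have : (2 * Real.pi) ≠ 0 := by positivity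
    simp
    field_simp
    ring
  have hc := hS.constant_of_mapsTo (T := Set.range ((↑) : ℤ → ℝ)) 
    ⟨Int.isClosedEmbedding_coe_real.isEmbedding.toHomeomorph.symm.isEmbedding.discreteTopology⟩ him hT hx hy
  obtain ⟨k, hk⟩ := key y hy
  have : (2 * Real.pi) ≠ 0 := by positivity
  have hk0 : (k : ℝ) = 0 := by
    simp only [hk] at hc
    simp at hc
    rw [eq_comm, ← sub_div, div_eq_zero_iff, add_sub_cancel_left] at hc
    simpa [Real.pi_ne_zero] using hc
  rw [hk]
  simp [Int.cast_eq_zero.1 hk0]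

/-- A continuous nonvanishing function on a simply connected space has a continuous logarithm with
a prescribed value. -/
theorem exists_continuous_log {X : Type*} [TopologicalSpace X] [SimplyConnectedSpace X]
    [LocallyPathConnectedSpace X] {g : X → ℂ} (hg : Continuous g) (h0 : ∀ x, g x ≠ 0) {x₀ : X}
    {c : ℂ} (hc : Complex.exp c = g x₀) :
    ∃ θ : X → ℂ, Continuous θ ∧ θ x₀ = c ∧ ∀ x, Complex.exp (θ x) = g x := by
  obtain ⟨F, ⟨hF0, hF⟩, -⟩ := Complex.isCoveringMapOn_exp.existsUnique_continuousMap_lifts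
    ⟨g, hg⟩ (a₀ := x₀) (e₀ := c) hc (fun x => h0 x)
  exact ⟨F, F.continuous, hF0, fun x => congrFun hF x⟩

/-- A curve running from the far left to the far right inside a horizontal strip meets every path
from above the strip to below it. -/
theorem exists_eq_of_crosses_strip {γ σ : ℝ → ℂ} (hγ : Continuous γ) (hσ : Continuous σ) {B : ℝ}
    (hB : ∀ t, |(γ t).im| ≤ B) (hbot : Tendsto (fun t => (γ t).re) atBot atBot)
    (htop : Tendsto (fun t => (γ t).re) atTop atTop) (h0 : B < (σ 0).im) (h1 : (σ 1).im < -B) :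
    ∃ s ∈ Set.Icc (0 : ℝ) 1, ∃ t, γ t = σ s := by
  by_contra! hne
  set p : ℝ → ℝ := fun s => max 0 (min 1 s) with hp
  have hpc : Continuous p := by fun_prop
  have hp01 : ∀ s, p s ∈ Set.Icc (0 : ℝ) 1 := fun s =>
    ⟨le_max_left _ _, max_le zero_le_one (min_le_left _ _)⟩
  have hp0 : p 0 = 0 := by simp [hp]
  have hp1 : p 1 = 1 := by simp [hp]
  -- If the curves never met, `h` would have a continuous logarithm on the plane. Yet `h` winds once
  -- around `0` along the boundary of `[0, 1] × [T₀, T₁]`, its four sides being mapped into four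
  -- half-planes.
  set h : ℝ × ℝ → ℂ := fun x => γ x.2 - σ (p x.1) with hh
  have hhc : Continuous h := by fun_prop
  have hhne : ∀ x, h x ≠ 0 := fun x => sub_ne_zero.2 (hne _ (hp01 x.1) _)
  obtain ⟨θ, hθc, -, hθ⟩ := exists_continuous_log hhc hhne
    (x₀ := (0, 0)) (Complex.exp_log (hhne (0, 0)))
  obtain ⟨C, hC⟩ := (isCompact_Icc (a := (0 : ℝ)) (b := 1)).exists_bound_of_continuousOn
    (hσ.continuousOn)
  have hCre : ∀ s, |(σ (p s)).re| ≤ C := fun s =>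
    (Complex.abs_re_le_norm _).trans (hC _ (hp01 s))
  obtain ⟨T₁, hT₁⟩ := (htop.eventually_gt_atTop C).exists
  obtain ⟨T₀, hT₀⟩ := (hbot.eventually_lt_atBot (-C)).exists
  have hbelow : ∀ t, (h (0, t)).im < 0 := fun t => by
    have := (abs_le.1 (hB t)).2
    simp only [hh, hp0, Complex.sub_im]; linarith
  have habove : ∀ t, 0 < (h (1, t)).im := fun t => by
    have := (abs_le.1 (hB t)).1
    simp only [hh, hp1, Complex.sub_im]; linarith
  have hright : ∀ s, 0 < (h (s, T₁)).re := fun s => by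
    have := (abs_le.1 (hCre s)).2
    simp only [hh, Complex.sub_re]; linarith
  have hleft : ∀ s, (h (s, T₀)).re < 0 := fun s => by
    have := (abs_le.1 (hCre s)).1
    simp only [hh, Complex.sub_re]; linarith
  -- the difference to the principal logarithm is constant on each of three sides
  have side : ∀ e : ℝ → ℝ × ℝ, Continuous e → (∀ t, h (e t) ∈ Complex.slitPlane) →
      ∀ s t, θ (e s) - Complex.log (h (e s)) = θ (e t) - Complex.log (h (e t)) := by
    intro e he hsl s t
    refine isPreconnected_univ.eqOn_of_exp_eq (c := 1)
      (θ := fun t => θ (e t) - Complex.log (h (e t))) ?_ ?_ (Set.mem_univ s) (Set.mem_univ t)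
    · exact ((hθc.comp he).sub ((hhc.comp he).clog hsl)).continuousOn
    · intro t _
      rw [Complex.exp_sub, hθ, Complex.exp_log (hhne _), div_self (hhne _)]
  have e1 := side (fun t => (0, t)) (by fun_prop)
    (fun t => Or.inr (hbelow t).ne) T₀ T₁
  have e2 := side (fun s => (s, T₁)) (by fun_prop) (fun s => Or.inl (hright s)) 0 1
  have e3 := side (fun t => (1, t)) (by fun_prop)
    (fun t => Or.inr (habove t).ne') T₁ T₀
  -- On the fourth side `h` may cross the branch cut, so the logarithm of `-h` is used; the
  -- corrections `±πi` at the two corners add up to the winding `2πi`.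
  have e4 : θ (0, T₀) - Complex.log (-h (0, T₀)) = θ (1, T₀) - Complex.log (-h (1, T₀)) := by
    refine isPreconnected_univ.eqOn_of_exp_eq (c := -1)
      (θ := fun s : ℝ => θ (s, T₀) - Complex.log (-h (s, T₀))) ?_ ?_
      (Set.mem_univ 0) (Set.mem_univ 1)
    · refine Continuous.continuousOn ?_
      refine (hθc.comp (by fun_prop)).sub (Continuous.clog (by fun_prop) fun s => Or.inl ?_)
      simpa using hleft s
    · intro s _
      rw [Complex.exp_sub, hθ, Complex.exp_log (neg_ne_zero.2 (hhne _)), div_neg,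
        div_self (hhne _)]
  have l0 : Complex.log (-h (0, T₀)) = Complex.log (h (0, T₀)) + Real.pi * Complex.I := by
    simp only [Complex.log, norm_neg, Complex.arg_neg_eq_arg_add_pi_of_im_neg (hbelow T₀)]
    push_cast; ring
  have l1 : Complex.log (-h (1, T₀)) = Complex.log (h (1, T₀)) - Real.pi * Complex.I := by
    simp only [Complex.log, norm_neg, Complex.arg_neg_eq_arg_sub_pi_of_im_pos (habove T₀)]
    push_cast; ring
  have : (2 * Real.pi * Complex.I : ℂ) = 0 := by
    rw [l0, l1] at e4
    linear_combination e1 + e2 + e3 - e4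
  simp [Real.pi_ne_zero] at this

/-! ### Lifted curves and a curve across the basin -/

section Curves

variable {κ : ℂ}

/-- A lift under `expMap κ` of a curve tending to `±∞` tends to `+∞` with bounded imaginary
part. -/
theorem exists_lift_expMap {γ : ℝ → ℂ} (hγ : Continuous γ) (hne : ∀ t, γ t ≠ κ) {e : ℝ}
    (he : e ≠ 0) (hlim : Tendsto (fun t => e * (γ t).re) atTop atTop) {z₀ : ℂ}
    (hz₀ : expMap κ z₀ = γ 0) :
    ∃ δ : ℝ → ℂ, Continuous δ ∧ δ 0 = z₀ ∧ (∀ t, expMap κ (δ t) = γ t) ∧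
      Tendsto (fun t => (δ t).re) atTop atTop ∧ ∃ B, ∀ t, 0 ≤ t → |(δ t).im| ≤ B := by
  obtain ⟨δ, hδ, h0, hexp⟩ := exists_continuous_log (g := fun t => γ t - κ) (by fun_prop)
    (fun t => sub_ne_zero.2 (hne t)) (x₀ := 0) (c := z₀) (by rw [← hz₀]; simp [expMap])
  have hlim' : Tendsto (fun t => e * (γ t - κ).re) atTop atTop := by
    simp only [Complex.sub_re, mul_sub]
    exact tendsto_atTop_add_const_right _ (-(e * κ.re)) hlim
  refine ⟨δ, hδ, h0, fun t => by simp [expMap, hexp], ?_, ?_⟩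
  · have hre : ∀ t, (δ t).re = Real.log ‖γ t - κ‖ := fun t => by
      rw [← hexp, Complex.norm_exp, Real.log_exp]
    simp only [hre]
    refine Real.tendsto_log_atTop.comp ?_
    have h1 : Tendsto (fun t => |e| * ‖γ t - κ‖) atTop atTop := by
      refine tendsto_atTop_mono (fun t => ?_) hlim'
      refine (le_abs_self _).trans ?_
      rw [abs_mul]
      gcongr
      exact Complex.abs_re_le_norm _
    exact (tendsto_const_mul_atTop_of_pos (abs_pos.2 he)).1 h1
  -- From time `T` on, `e * (γ t - κ)` stays in the right half-plane, so the lift differs from its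
  -- principal logarithm by a constant, and the argument is at most `π`.
  · obtain ⟨T, hT⟩ := eventually_atTop.1 (hlim'.eventually_gt_atTop 0)
    have hsl : ∀ t ∈ Set.Ici T, (e : ℂ) * (γ t - κ) ∈ Complex.slitPlane := fun t ht =>
      Or.inl (by simpa using hT t ht)
    have hconst : ∀ t ∈ Set.Ici T, δ t - Complex.log (e * (γ t - κ)) =
        δ T - Complex.log (e * (γ T - κ)) := by
      intro t ht
      refine (isPreconnected_Ici (a := T)).eqOn_of_exp_eq (c := (e : ℂ)⁻¹)
        (θ := fun t => δ t - Complex.log (e * (γ t - κ))) ?_ ?_ ht Set.self_mem_Ici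
      · exact hδ.continuousOn.sub (ContinuousOn.clog (by fun_prop) hsl)
      · intro s hs
        have h1 : γ s - κ ≠ 0 := sub_ne_zero.2 (hne s)
        have h2 : (e : ℂ) ≠ 0 := Complex.ofReal_ne_zero.2 he
        rw [Complex.exp_sub, hexp, Complex.exp_log (Complex.slitPlane_ne_zero (hsl s hs))]
        field_simp
    obtain ⟨C, hC⟩ := (isCompact_Icc (a := (0 : ℝ)) (b := T)).exists_bound_of_continuousOn
      hδ.continuousOn
    set c := δ T - Complex.log (e * (γ T - κ))
    refine ⟨max C (‖c‖ + Real.pi), fun t ht => ?_⟩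
    rcases le_total t T with h | h
    · exact ((Complex.abs_im_le_norm _).trans (hC t ⟨ht, h⟩)).trans (le_max_left _ _)
    · refine le_trans ?_ (le_max_right _ _)
      have h1 : δ t = c + Complex.log (e * (γ t - κ)) := by rw [← hconst t h]; ring
      rw [h1, Complex.add_im, Complex.log_im]
      exact (abs_add_le _ _).trans
        (add_le_add (Complex.abs_im_le_norm _) (Complex.abs_arg_le_pi _))

/-- Lifts one exponential at a time. Avoiding the orbit of the omitted value `κ` keeps every lift
possible. Only the first lift starts from a curve going left (`e = -1`); later ones go right (`e =
1`). -/
theorem exists_lift_iterate_expMap {γ : ℝ → ℂ} (hγ : Continuous γ) (k : ℕ)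
    (hne : ∀ j ≤ k, ∀ t, γ t ≠ (expMap κ)^[j] κ)
    (hlim : Tendsto (fun t => (γ t).re) atTop atBot) {z₀ : ℂ}
    (hz₀ : (expMap κ)^[k + 1] z₀ = γ 0) :
    ∃ δ : ℝ → ℂ, Continuous δ ∧ δ 0 = z₀ ∧ (∀ t, (expMap κ)^[k + 1] (δ t) = γ t) ∧
      Tendsto (fun t => (δ t).re) atTop atTop ∧ ∃ B, ∀ t, 0 ≤ t → |(δ t).im| ≤ B := by
  induction k generalizing z₀ with
  | zero =>
    exact exists_lift_expMap hγ (hne 0 le_rfl) (e := -1) (by norm_num)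
      (by simpa only [neg_one_mul, Function.comp_def] using tendsto_neg_atBot_atTop.comp hlim) hz₀
  | succ k ih =>
    obtain ⟨γ₁, hc, h0, hlift, htop, -⟩ := ih (fun j hj => hne j (by omega))
      (z₀ := expMap κ z₀) hz₀
    obtain ⟨δ, hδ, hδ0, hδl, hδt, hδB⟩ := exists_lift_expMap hc
      (fun t ht => hne (k + 1) le_rfl t (by rw [← hlift t, ht])) (e := 1) one_ne_zero
      (by simpa using htop) h0.symm
    refine ⟨δ, hδ, hδ0, fun t => ?_, hδt, hδB⟩
    rw [Function.iterate_succ_apply, hδl, hlift]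

/-- If an immediate basin contains a left half-plane, and a point that some iterate maps far to
the left, then it contains a curve from `-∞` to `+∞` with bounded imaginary part. -/
theorem exists_curve_in_immediateBasin {a : ℂ} {R : ℝ}
    (hR : {z : ℂ | z.re < R} ⊆ immediateBasin (expMap κ) a) (k : ℕ) {b z₀ : ℂ}
    (hbR : b.re < R) (hb : ∀ j ≤ k, b.re < ((expMap κ)^[j] κ).re)
    (hz₀ : z₀ ∈ immediateBasin (expMap κ) a) (hz₀b : (expMap κ)^[k + 1] z₀ = b) :
    ∃ δ : ℝ → ℂ, Continuous δ ∧ (∀ t, δ t ∈ immediateBasin (expMap κ) a) ∧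
      Tendsto (fun t => (δ t).re) atBot atBot ∧ Tendsto (fun t => (δ t).re) atTop atTop ∧
      ∃ B, ∀ t, |(δ t).im| ≤ B := by
  set A := immediateBasin (expMap κ) a with hA
  have hbA : b ∈ A := hR hbR
  have hAF := immediateBasin_subset_fatouSet (expMap κ) a
  have hpc : IsPathConnected A := (isOpen_immediateBasin _ _).isConnected_iff_isPathConnected.1
    ⟨⟨b, hbA⟩, isPreconnected_immediateBasin _ _⟩
  obtain ⟨p, hp⟩ := hpc.joinedIn b hbA z₀ hz₀
  have hray : ∀ t : ℝ, (b - (|t| : ℝ)).re ≤ b.re := fun t => by simp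
  have hrayA : ∀ t : ℝ, b - (|t| : ℝ) ∈ A := fun t => hR ((hray t).trans_lt hbR)
  obtain ⟨η, hη, hη0, hηl, hηt, B, hB⟩ := exists_lift_iterate_expMap
    (γ := fun t => b - (|t| : ℝ)) (z₀ := z₀) (by fun_prop) k
    (fun j hj t h => absurd (hb j hj) (not_lt.2 (h ▸ hray t)))
    (by
      simp only [Complex.sub_re, Complex.ofReal_re]
      exact tendsto_atBot_add_const_left _ _ (tendsto_neg_atTop_atBot.comp tendsto_abs_atTop_atTop))
    (by simpa using hz₀b)
  have hηA : ∀ t, η t ∈ A := by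
    have := (isPreconnected_range hη).subset_immediateBasin (a := a) (f := expMap κ) ?_
      (z := z₀) ⟨0, hη0⟩ hz₀
    · exact fun t => this ⟨t, rfl⟩
    · rintro _ ⟨t, rfl⟩
      refine mem_fatouSet_of_iterate_mem (continuous_expMap κ) (k + 1) ?_
      rw [hηl]
      exact hAF (hrayA t)
  obtain ⟨C, hC⟩ := (isCompact_Icc (a := (0 : ℝ)) (b := 1)).exists_bound_of_continuousOn
    p.continuous_extend.continuousOn
  have hpA : ∀ t, p.extend t ∈ A := fun t => hp _
  -- Three pieces: the ray from `-∞` to `b`, a path in the basin from `b` to `z₀`, and the lift of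
  -- the ray starting at `z₀`.
  set δ : ℝ → ℂ := fun t =>
    if t ≤ 0 then b - (|t| : ℝ) else if t ≤ 1 then p.extend t else η (t - 1) with hδ
  have hδ_neg : ∀ t ≤ 0, δ t = b - (|t| : ℝ) := fun t ht => by simp [hδ, ht]
  have hδ_pos : ∀ t, 1 < t → δ t = η (t - 1) := fun t ht => by
    simp [hδ, not_le.2 ht, not_le.2 (zero_lt_one.trans ht)]
  refine ⟨δ, ?_, fun t => ?_, ?_, ?_, max (max |b.im| C) B, fun t => ?_⟩
  · refine Continuous.if_le (by fun_prop) ?_ continuous_id continuous_const ?_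
    · refine Continuous.if_le p.continuous_extend (by fun_prop) continuous_id continuous_const ?_
      rintro t rfl
      simp [hη0]
    · rintro t rfl
      simp
  · simp only [hδ]
    split_ifs
    exacts [hrayA t, hpA t, hηA _]
  · have h1 : Tendsto (fun t : ℝ => b.re + t) atBot atBot :=
      tendsto_atBot_add_const_left _ _ tendsto_id
    refine h1.congr' ?_
    filter_upwards [eventually_le_atBot 0] with t ht
    rw [hδ_neg t ht, abs_of_nonpos ht]
    simp
  · have h1 : Tendsto (fun t : ℝ => (η (t - 1)).re) atTop atTop :=
      hηt.comp (tendsto_atTop_add_const_right _ (-1) tendsto_id)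
    refine h1.congr' ?_
    filter_upwards [eventually_gt_atTop 1] with t ht
    rw [hδ_pos t ht]
  · simp only [hδ]
    split_ifs with h0 h1
    · simp
    · refine le_trans ?_ ((le_max_right _ _).trans (le_max_left _ _))
      exact (Complex.abs_im_le_norm _).trans (hC t ⟨(not_le.1 h0).le, h1⟩)
    · exact (hB _ (by linarith [not_le.1 h1])).trans (le_max_right _ _)

/-- A path-connected set that avoids all `2πi`-translates of a curve running from `-∞` to `+∞` in
a horizontal strip has bounded imaginary part. -/
theorem exists_abs_im_le_of_disjoint_translates {δ : ℝ → ℂ} (hδ : Continuous δ)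
    (hbot : Tendsto (fun t => (δ t).re) atBot atBot)
    (htop : Tendsto (fun t => (δ t).re) atTop atTop) {B : ℝ} (hB : ∀ t, |(δ t).im| ≤ B)
    {S : Set ℂ} (hS : IsPathConnected S)
    (hdisj : ∀ t (k : ℤ), δ t + 2 * Real.pi * Complex.I * k ∉ S) :
    ∃ C, ∀ y ∈ S, |y.im| ≤ C := by
  have hpi := Real.pi_pos
  have cross : ∀ (k : ℤ), ∀ y ∈ S, ∀ y' ∈ S,
      B + 2 * Real.pi * k < y.im → y'.im < -B + 2 * Real.pi * k → False := by
    intro k y hy y' hy' h1 h2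
    obtain ⟨p, hp⟩ := hS.joinedIn y hy y' hy'
    obtain ⟨s, -, t, hst⟩ := exists_eq_of_crosses_strip hδ
      (σ := fun s => p.extend s - 2 * Real.pi * Complex.I * k)
      (p.continuous_extend.sub continuous_const) hB hbot htop
      (by simp; linarith) (by simp; linarith)
    refine hdisj t k ?_
    rw [hst, sub_add_cancel]
    exact hp _
  obtain ⟨q, hq⟩ := hS.nonempty
  -- The `k`-th translated strip lies above `q` and the `l`-th below it; a path in `S` from `q`
  -- beyond either strip would meet a translated curve.
  obtain ⟨k, hk⟩ := exists_int_gt ((q.im + B) / (2 * Real.pi))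
  obtain ⟨l, hl⟩ := exists_int_lt ((q.im - B) / (2 * Real.pi))
  rw [div_lt_iff₀ (by positivity)] at hk
  rw [lt_div_iff₀ (by positivity)] at hl
  refine ⟨max (B + 2 * Real.pi * k) (-(-B + 2 * Real.pi * l)), fun y hy => abs_le'.2 ⟨?_, ?_⟩⟩
  · refine le_trans ?_ (le_max_left _ _)
    by_contra! h
    exact cross k y hy q hq h (by linarith)
  · refine le_trans ?_ (le_max_right _ _)
    by_contra! h
    exact cross l q hq y hy (by linarith) (by linarith)

end Curves

/-! ### The return map on the basin: inverse growth and translations -/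

section Basin

variable {κ κ₀ a : ℂ} {n : ℕ} {R : ℝ} {Ψ : ℂ → ℂ}

/-- A logarithm of `Ψ ζ - κ₀` lies in the Fatou set of `expMap κ₀` by backward invariance, hence is
a value `Ψ z`; injectivity of `Ψ` turns the conjugacy into `f^[n] z = ζ`. -/
theorem exists_iterate_eq_of_conjugacy (hper : (expMap κ)^[n] a = a)
    (hΨ : IsConformalConjugacy Ψ ((expMap κ)^[n]) (expMap κ₀)
      (immediateBasin (expMap κ) a) (fatouSet (expMap κ₀)))
    {ζ : ℂ} (hζ : ζ ∈ immediateBasin (expMap κ) a) (hne : Ψ ζ ≠ κ₀) :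
    ∃ z ∈ immediateBasin (expMap κ) a, (expMap κ)^[n] z = ζ := by
  obtain ⟨-, hbij, hconj⟩ := hΨ
  have hy : expMap κ₀ (Complex.log (Ψ ζ - κ₀)) = Ψ ζ := by
    rw [expMap, Complex.exp_log (sub_ne_zero.2 hne), sub_add_cancel]
  obtain ⟨z, hz, hzy⟩ := hbij.surjOn
    (mem_fatouSet_of_apply_mem (continuous_expMap κ₀) (hy.symm ▸ hbij.mapsTo hζ))
  refine ⟨z, hz, hbij.injOn (mapsTo_iterate_immediateBasin hper hz) hζ ?_⟩
  rw [hconj z hz, hzy, hy]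

/-- At most one point of `A` has the value `c`. With `c = κ₀`, all points high enough have preimages
under the return map. -/
theorem exists_forall_ne_of_injOn {A : Set ℂ} (h : Set.InjOn Ψ A) (c : ℂ) :
    ∃ Y : ℝ, ∀ ζ ∈ A, Y ≤ ζ.im → Ψ ζ ≠ c := by
  by_cases hex : ∃ ζ ∈ A, Ψ ζ = c
  · obtain ⟨ζ₀, h₀, rfl⟩ := hex
    refine ⟨ζ₀.im + 1, fun ζ hζ hY heq => ?_⟩
    rw [h hζ h₀ heq] at hY
    linarith
  · exact ⟨0, fun ζ hζ _ heq => hex ⟨ζ, hζ, heq⟩⟩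

/-- The images of the immediate basin that do not contain a left half-plane have bounded imaginary
part. -/
theorem exists_abs_im_iterate_le (hn : 0 < n) (ha : IsAttractingPeriodicPt (expMap κ) n a)
    (hR : {z : ℂ | z.re < R} ⊆ immediateBasin (expMap κ) a)
    (hΨ : IsConformalConjugacy Ψ ((expMap κ)^[n]) (expMap κ₀)
      (immediateBasin (expMap κ) a) (fatouSet (expMap κ₀))) :
    ∃ C, ∀ z ∈ immediateBasin (expMap κ) a, ∀ j, 0 < j → j < n →
      |((expMap κ)^[j] z).im| ≤ C := by
  have hper : (expMap κ)^[n] a = a := ha.2.1 ▸ Function.iterate_minimalPeriod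
  obtain ⟨Y, hY⟩ := exists_forall_ne_of_injOn hΨ.2.1.injOn κ₀
  obtain ⟨x, hxR, hx⟩ := ((eventually_lt_atBot R).and
    ((eventually_all_finset (Finset.range n)).2 fun j _ =>
      eventually_lt_atBot ((expMap κ)^[j] κ).re)).exists
  have hbA : (⟨x, Y⟩ : ℂ) ∈ immediateBasin (expMap κ) a := hR hxR
  obtain ⟨z₀, hz₀, hz₀b⟩ := exists_iterate_eq_of_conjugacy hper hΨ hbA (hY _ hbA le_rfl)
  obtain ⟨k, rfl⟩ := Nat.exists_eq_succ_of_ne_zero hn.ne'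
  obtain ⟨δ, hδ, hδA, hbot, htop, B, hB⟩ := exists_curve_in_immediateBasin hR k (b := ⟨x, Y⟩)
    hxR (fun j hj => hx j (Finset.mem_range.2 (by omega))) hz₀ hz₀b
  have hpc : IsPathConnected (immediateBasin (expMap κ) a) :=
    (isOpen_immediateBasin _ _).isConnected_iff_isPathConnected.1
      ⟨⟨_, hbA⟩, isPreconnected_immediateBasin _ _⟩
  have key : ∀ j, ∃ C, 0 < j → j < k + 1 → ∀ z ∈ immediateBasin (expMap κ) a,
      |((expMap κ)^[j] z).im| ≤ C := by
    intro j
    by_cases hj : 0 < j ∧ j < k + 1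
    · obtain ⟨C, hC⟩ := exists_abs_im_le_of_disjoint_translates hδ hbot htop hB
        (hpc.image (differentiable_iterate_expMap κ j).continuous) (fun t l ht => by
          obtain ⟨z, hz, hzt⟩ := ht
          exact iterate_notMem_immediateBasin (differentiable_expMap κ) ha hj.1 hj.2 hz
            (hzt ▸ add_two_pi_mul_int_mem_immediateBasin hR (hδA t) l))
      exact ⟨C, fun _ _ z hz => hC _ ⟨z, hz, rfl⟩⟩
    · exact ⟨0, fun h1 h2 => absurd ⟨h1, h2⟩ hj⟩
  choose C hC using key
  obtain ⟨C', hC'⟩ := ((eventually_all_finset (Finset.range (k + 1))).2 fun j _ =>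
      eventually_ge_atTop (C j)).exists
  exact ⟨C', fun z hz j h1 h2 => (hC j h1 h2 z hz).trans (hC' j (Finset.mem_range.2 h2))⟩

theorem exp_re_eq_norm_expMap_sub (κ w : ℂ) : Real.exp w.re = ‖expMap κ w - κ‖ := by
  simp [expMap, Complex.norm_exp]

theorem re_le_log_norm_expMap (κ w : ℂ) : w.re ≤ Real.log (1 + ‖κ‖ + ‖expMap κ w‖) := by
  rw [Real.le_log_iff_exp_le (by positivity), exp_re_eq_norm_expMap_sub κ]
  linarith [norm_sub_le (expMap κ w) κ]

/-- In a right half-strip the modulus is controlled by the real part, which is logarithmic in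
`‖expMap κ w‖`. -/
theorem norm_le_of_expMap {C₀ C : ℝ} {w : ℂ} (him : |w.im| ≤ C₀) (hre : R ≤ w.re)
    (hC : C₀ + |R| + ‖κ‖ + 1 ≤ C) : ‖w‖ ≤ C + Real.log (C + ‖expMap κ w‖) := by
  have h0 : 0 ≤ C₀ := (abs_nonneg _).trans him
  have h1 := re_le_log_norm_expMap κ w
  have h2 : Real.log (1 + ‖κ‖ + ‖expMap κ w‖) ≤ Real.log (C + ‖expMap κ w‖) := by
    apply Real.log_le_log (by positivity)
    linarith [abs_nonneg R]
  have h3 : 0 ≤ Real.log (1 + ‖κ‖ + ‖expMap κ w‖) := by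
    apply Real.log_nonneg
    linarith [norm_nonneg κ, norm_nonneg (expMap κ w)]
  have h4 : |w.re| ≤ |R| + Real.log (C + ‖expMap κ w‖) :=
    abs_le.2 ⟨by linarith [neg_abs_le R], by linarith [abs_nonneg R]⟩
  linarith [Complex.norm_le_abs_re_add_abs_im w, norm_nonneg κ]

/-- Points high up in the basin have a preimage under the return map which is again high up and
whose modulus is bounded by a double logarithm. -/
theorem exists_preimage_norm_le (hn : 1 < n) (ha : IsAttractingPeriodicPt (expMap κ) n a)
    (hR : {z : ℂ | z.re < R} ⊆ immediateBasin (expMap κ) a)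
    (hΨ : IsConformalConjugacy Ψ ((expMap κ)^[n]) (expMap κ₀)
      (immediateBasin (expMap κ) a) (fatouSet (expMap κ₀))) :
    ∃ Y C : ℝ, 1 ≤ C ∧ ∀ ζ ∈ immediateBasin (expMap κ) a, Y ≤ ζ.im →
      ∃ z ∈ immediateBasin (expMap κ) a, Y ≤ z.im ∧ (expMap κ)^[n] z = ζ ∧
        ‖z‖ ≤ C + Real.log (C + Real.log (C + ‖ζ‖)) := by
  have hper : (expMap κ)^[n] a = a := ha.2.1 ▸ Function.iterate_minimalPeriod
  obtain ⟨Y₀, hY₀⟩ := exists_forall_ne_of_injOn hΨ.2.1.injOn κ₀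
  obtain ⟨C₀, hC₀⟩ := exists_abs_im_iterate_le (by omega) ha hR hΨ
  obtain ⟨m, rfl⟩ : ∃ m, n = m + 2 := ⟨n - 2, by omega⟩
  set f := expMap κ with hf
  set v := f^[m + 1] κ with hv
  obtain ⟨δ, hδ, hδv⟩ := Metric.continuousAt_iff.1
    ((differentiable_iterate_expMap κ (m + 1)).continuous.continuousAt (x := κ)) 1 one_pos
  -- The bound `v.im + 1` keeps `ζ` at distance at least `1` from `v`, hence `f z` at distance at
  -- least `δ` from `κ`. This bounds `z.re` from below, although the basin extends to the far left.
  set Y := max Y₀ (v.im + 1) with hYdef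
  have h00 : 0 ≤ C₀ :=
    (abs_nonneg _).trans (hC₀ a (mem_immediateBasin_self ⟨(R - 1 : ℝ), hR (by simp)⟩) 1 one_pos
      (by omega))
  set C₁ := C₀ + |R| + ‖κ‖ + 1 with hC₁
  have hC₁1 : 1 ≤ C₁ := by linarith [abs_nonneg R, norm_nonneg κ]
  refine ⟨Y, |Real.log δ| + |Y| + 2 * Real.pi + 2 * C₁ + 2 * C₁ * m + ‖κ‖, ?_,
    fun ζ hζ hYζ => ?_⟩
  · have : 0 ≤ 2 * C₁ * m := by positivity
    linarith [abs_nonneg (Real.log δ), abs_nonneg Y, Real.pi_pos, norm_nonneg κ]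
  obtain ⟨z', hz', hz'ζ⟩ := exists_iterate_eq_of_conjugacy hper hΨ hζ
    (hY₀ ζ hζ ((le_max_left _ _).trans hYζ))
  -- A `2πi`-translate of the preimage has imaginary part in `[Y, Y + 2π)` and the same image.
  obtain ⟨l, ⟨hl1, hl2⟩, -⟩ := existsUnique_add_zsmul_mem_Ico Real.two_pi_pos z'.im Y
  set z := z' + 2 * Real.pi * Complex.I * l with hzdef
  have hzA : z ∈ immediateBasin f a := add_two_pi_mul_int_mem_immediateBasin hR hz' l
  have hzim : z.im = z'.im + l • (2 * Real.pi) := by simp [hzdef, mul_comm]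
  have hzζ : f^[m + 2] z = ζ := by
    rw [hzdef, hf, iterate_expMap_add_two_pi_mul_int _ _ _ (by omega), ← hf, hz'ζ]
  rw [← hzim] at hl1 hl2
  refine ⟨z, hzA, hl1, hzζ, ?_⟩
  have hstep : ∀ j, 0 < j → j < m + 2 → ‖f^[j] z‖ ≤ C₁ + Real.log (C₁ + ‖f^[j + 1] z‖) := by
    intro j h1 h2
    rw [Function.iterate_succ_apply']
    refine norm_le_of_expMap (hC₀ z hzA j h1 h2) (R := R) ?_ le_rfl
    by_contra! h
    exact iterate_notMem_immediateBasin (differentiable_expMap κ) ha h1 h2 hzA (hR h)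
  -- Only two logarithms are needed, so the steps from `ζ` back to `f^[2] z` use just `log x ≤ x`;
  -- the last two steps, to `f z` and to `z`, keep theirs.
  have hcoarse : ∀ i ≤ m, ‖f^[m + 2 - i] z‖ ≤ 2 * C₁ * i + ‖ζ‖ := by
    intro i
    induction i with
    | zero => simp [hzζ]
    | succ i ih =>
      intro hi
      have h1 := hstep (m + 2 - (i + 1)) (by omega) (by omega)
      rw [show m + 2 - (i + 1) + 1 = m + 2 - i by omega] at h1
      have h2 := Real.log_le_self (add_nonneg (zero_le_one.trans hC₁1) (norm_nonneg (f^[m + 2 - i] z)))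
      rw [Nat.cast_succ]
      linarith [ih (by omega)]
  have h1 : ‖f z‖ ≤ C₁ + Real.log (C₁ + (2 * C₁ * m + ‖ζ‖)) := by
    refine (hstep 1 one_pos (by omega)).trans ?_
    have := hcoarse m le_rfl
    rw [show m + 2 - m = 1 + 1 by omega] at this
    gcongr
  have hδz : δ ≤ ‖f z - κ‖ := by
    by_contra! h
    have h2 := hδv (x := f z) (by rwa [dist_eq_norm])
    rw [← hf, ← hv, ← Function.iterate_succ_apply, hzζ, dist_eq_norm] at h2
    have h3 := (Complex.abs_im_le_norm (ζ - v)).trans_lt h2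
    rw [Complex.sub_im] at h3
    linarith [(abs_lt.1 h3).2, le_max_right Y₀ (v.im + 1)]
  have hre1 : Real.log δ ≤ z.re := by
    rw [Real.log_le_iff_le_exp hδ, exp_re_eq_norm_expMap_sub κ]
    exact hδz
  have hre2 := re_le_log_norm_expMap κ z
  have hre3 : 0 ≤ Real.log (1 + ‖κ‖ + ‖expMap κ z‖) := by
    apply Real.log_nonneg
    linarith [norm_nonneg κ, norm_nonneg (expMap κ z)]
  have hre : |z.re| ≤ |Real.log δ| + Real.log (1 + ‖κ‖ + ‖expMap κ z‖) :=
    abs_le.2 ⟨by linarith [neg_abs_le (Real.log δ)], by linarith [abs_nonneg (Real.log δ)]⟩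
  have him : |z.im| ≤ |Y| + 2 * Real.pi :=
    abs_le.2 ⟨by linarith [neg_abs_le Y, Real.pi_pos], by linarith [le_abs_self Y]⟩
  have hm : 0 ≤ 2 * C₁ * m := by positivity
  set C := |Real.log δ| + |Y| + 2 * Real.pi + 2 * C₁ + 2 * C₁ * m + ‖κ‖ with hC
  have hpi := Real.pi_pos
  have hlog : Real.log (C₁ + (2 * C₁ * m + ‖ζ‖)) ≤ Real.log (C + ‖ζ‖) := by
    apply Real.log_le_log (by positivity)
    linarith [abs_nonneg (Real.log δ), abs_nonneg Y, norm_nonneg κ]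
  have hlog2 : Real.log (1 + ‖κ‖ + ‖expMap κ z‖) ≤ Real.log (C + Real.log (C + ‖ζ‖)) := by
    apply Real.log_le_log (by positivity)
    linarith [abs_nonneg (Real.log δ), abs_nonneg Y, norm_nonneg κ]
  linarith [Complex.norm_le_abs_re_add_abs_im z, norm_nonneg κ]

/-- The conjugacy maps `2πi`-translations to translations by a nonzero multiple of `2πi`. -/
theorem exists_translation_of_conjugacy (hn : 0 < n)
    (hR : {z : ℂ | z.re < R} ⊆ immediateBasin (expMap κ) a)
    (hΨ : IsConformalConjugacy Ψ ((expMap κ)^[n]) (expMap κ₀)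
      (immediateBasin (expMap κ) a) (fatouSet (expMap κ₀))) :
    ∃ c : ℂ, 2 * Real.pi ≤ ‖c‖ ∧ ∀ z ∈ immediateBasin (expMap κ) a, ∀ k : ℕ,
      Ψ (z + 2 * Real.pi * Complex.I * (k : ℤ)) = Ψ z + k * c := by
  obtain ⟨hd, hbij, hconj⟩ := hΨ
  set A := immediateBasin (expMap κ) a
  have hshift : ∀ z ∈ A, ∀ k : ℤ, z + 2 * Real.pi * Complex.I * k ∈ A :=
    fun z hz k => add_two_pi_mul_int_mem_immediateBasin hR hz k
  -- As `f^[n]` is `2πi`-periodic, the two values of `Ψ` have the same exponential; their difference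
  -- lies in `2πiℤ` and is constant on the connected basin.
  have hexp : ∀ z ∈ A, Complex.exp (Ψ (z + 2 * Real.pi * Complex.I * (1 : ℤ)) - Ψ z) = 1 := by
    intro z hz
    have h1 := hconj _ (hshift z hz 1)
    rw [iterate_expMap_add_two_pi_mul_int _ _ _ hn, hconj z hz] at h1
    have h2 : Complex.exp (Ψ z) = Complex.exp (Ψ (z + 2 * Real.pi * Complex.I * (1 : ℤ))) :=
      add_right_cancel h1
    rw [Complex.exp_sub, ← h2, div_self (Complex.exp_ne_zero _)]
  have hcont : ContinuousOn (fun z => Ψ (z + 2 * Real.pi * Complex.I * (1 : ℤ)) - Ψ z) A :=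
    (hd.continuousOn.comp (by fun_prop) fun z hz => hshift z hz 1).sub hd.continuousOn
  have hz₀ : ((R - 1 : ℝ) : ℂ) ∈ A := hR (by simp)
  set z₀ : ℂ := ((R - 1 : ℝ) : ℂ)
  set c := Ψ (z₀ + 2 * Real.pi * Complex.I * (1 : ℤ)) - Ψ z₀ with hc
  have hconst : ∀ z ∈ A, Ψ (z + 2 * Real.pi * Complex.I * (1 : ℤ)) = Ψ z + c := by
    intro z hz
    have := (isPreconnected_immediateBasin (expMap κ) a).eqOn_of_exp_eq hcont hexp hz hz₀
    exact sub_eq_iff_eq_add'.1 this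
  refine ⟨c, ?_, fun z hz k => ?_⟩
  · obtain ⟨l, hl⟩ := Complex.exp_eq_one_iff.1 (hexp z₀ hz₀)
    rw [← hc] at hl
    have hl0 : l ≠ 0 := by
      rintro rfl
      have h1 := hbij.injOn (hshift z₀ hz₀ 1) hz₀ (sub_eq_zero.1 (hc ▸ hl.trans (by simp)))
      simp [Real.pi_ne_zero] at h1
    have h1 : (1 : ℝ) ≤ |(l : ℝ)| := by exact_mod_cast Int.one_le_abs hl0
    rw [hl]
    simp only [norm_mul, Complex.norm_I, Complex.norm_real, Complex.norm_ofNat,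
      Complex.norm_intCast, Real.norm_eq_abs, abs_of_pos Real.pi_pos, mul_one]
    nlinarith [Real.pi_pos]
  · induction k with
    | zero => simp
    | succ k ih =>
      have := hconst _ (hshift z hz k)
      rw [ih] at this
      rw [show z + 2 * Real.pi * Complex.I * ((k + 1 : ℕ) : ℤ) =
        z + 2 * Real.pi * Complex.I * (k : ℤ) + 2 * Real.pi * Complex.I * (1 : ℤ) by
          push_cast; ring, this]
      push_cast; ring

end Basin

/-! ### Iterated exponential growth -/

section Growth

/-- For the growth function `G t = exp t + K`, the double logarithm of a multiple of `G (G u)` is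
of the order of `u`. -/
theorem exists_log_log_le {C K : ℝ} (hC : 1 ≤ C) (hK : 0 ≤ K) :
    ∃ t₀ : ℝ, 0 ≤ t₀ ∧ ∀ u, t₀ ≤ u →
      C + Real.log (C + Real.log (C + 4 * (Real.exp (Real.exp u + K) + K))) ≤ 4 * u := by
  -- The estimates below bound the left side by `C + u + (K + C + D)`, which is at most `2 * u` once
  -- `u` exceeds this threshold.
  refine ⟨C + (K + C + (C + 4 * K + 4)), by positivity, fun u hu => ?_⟩
  set D := C + 4 * K + 4 with hD
  have key : ∀ x D : ℝ, 0 ≤ x → 0 ≤ D → Real.exp x + D ≤ Real.exp (x + D) := by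
    intro x D hx hD
    rw [Real.exp_add]
    nlinarith [Real.add_one_le_exp D, Real.one_le_exp hx]
  have hD0 : 0 ≤ D := by positivity
  have hu0 : 0 ≤ u := le_trans (by positivity) hu
  set g := Real.exp u + K with hg
  have hg0 : 0 ≤ g := by positivity
  have h1 : Real.log (C + 4 * (Real.exp g + K)) ≤ g + D := by
    rw [Real.log_le_iff_le_exp (by positivity), Real.exp_add g D]
    nlinarith [Real.add_one_le_exp D, Real.one_le_exp hg0]
  have h0 : 0 ≤ Real.log (C + 4 * (Real.exp g + K)) := by
    apply Real.log_nonneg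
    have := Real.exp_pos g
    linarith
  have h2 : Real.log (C + Real.log (C + 4 * (Real.exp g + K))) ≤ u + (K + C + D) := by
    rw [Real.log_le_iff_le_exp (by positivity)]
    linarith [key u (K + C + D) hu0 (by positivity)]
  linarith

end Growth

section Growth

theorem add_nat_le_iterate_exp_add {K : ℝ} (hK : 0 ≤ K) (t : ℝ) (N : ℕ) :
    t + N ≤ (fun t => Real.exp t + K)^[N] t := by
  induction N with
  | zero => simp
  | succ N ih =>
    rw [Function.iterate_succ_apply']
    push_cast
    linarith [Real.add_one_le_exp ((fun t => Real.exp t + K)^[N] t)]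

variable {κ κ₀ a : ℂ} {n : ℕ} {Ψ : ℂ → ℂ}

/-- Pulling back a point of the basin along the return map `N` times reaches a bounded part of the
basin, while the modulus of its image under the conjugacy drops by at most `N` logarithms. -/
theorem exists_norm_le_iterate_of_conjugacy
    (hconj : ∀ z ∈ immediateBasin (expMap κ) a, Ψ ((expMap κ)^[n] z) = expMap κ₀ (Ψ z))
    {Y C t₀ : ℝ} (hC : 1 ≤ C)
    (hpre : ∀ ζ ∈ immediateBasin (expMap κ) a, Y ≤ ζ.im →
      ∃ z ∈ immediateBasin (expMap κ) a, Y ≤ z.im ∧ (expMap κ)^[n] z = ζ ∧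
        ‖z‖ ≤ C + Real.log (C + Real.log (C + ‖ζ‖)))
    (ht₀ : ∀ u, t₀ ≤ u →
      C + Real.log (C + Real.log (C + 4 * (Real.exp (Real.exp u + ‖κ₀‖) + ‖κ₀‖))) ≤ 4 * u)
    (N : ℕ) {ζ : ℂ} (hζ : ζ ∈ immediateBasin (expMap κ) a) (hY : Y ≤ ζ.im)
    (hN : ‖ζ‖ ≤ 4 * (fun t => Real.exp t + ‖κ₀‖)^[2 * N] t₀) :
    ∃ z ∈ immediateBasin (expMap κ) a, ‖z‖ ≤ 4 * t₀ ∧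
      ‖Ψ ζ‖ ≤ (fun t => Real.exp t + ‖κ₀‖)^[N] ‖Ψ z‖ := by
  induction N generalizing ζ with
  | zero => exact ⟨ζ, hζ, hN, le_rfl⟩
  | succ N ih =>
    obtain ⟨z₁, hz₁, hz₁Y, rfl, hle⟩ := hpre ζ hζ hY
    set u := (fun t => Real.exp t + ‖κ₀‖)^[2 * N] t₀ with hu
    have hut : t₀ ≤ u := by
      have := add_nat_le_iterate_exp_add (norm_nonneg κ₀) t₀ (2 * N)
      have h2 : (0 : ℝ) ≤ (2 * N : ℕ) := Nat.cast_nonneg _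
      linarith
    -- One pullback strips two exponentials from the bound on `‖ζ‖` but only one from the bound on
    -- `‖Ψ ζ‖`.
    rw [show 2 * (N + 1) = 2 * N + 1 + 1 by ring, Function.iterate_succ_apply',
      Function.iterate_succ_apply', ← hu] at hN
    have hz₁u : ‖z₁‖ ≤ 4 * u := by
      refine hle.trans (le_trans ?_ (ht₀ u hut))
      have : 0 ≤ Real.log (C + ‖(expMap κ)^[n] z₁‖) :=
        Real.log_nonneg (by linarith [norm_nonneg ((expMap κ)^[n] z₁)])
      gcongr
    obtain ⟨z, hz, hzt, hzΨ⟩ := ih hz₁ hz₁Y hz₁u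
    refine ⟨z, hz, hzt, ?_⟩
    rw [hconj z₁ hz₁, Function.iterate_succ_apply', expMap]
    refine (norm_add_le _ _).trans ?_
    gcongr
    exact (Complex.norm_exp_le_exp_norm _).trans (Real.exp_le_exp.2 hzΨ)

end Growth

/-! ### The contradiction -/

theorem theorem3 (κ : ℂ) (n : ℕ) (hn : 1 < n) (a : ℂ)
    (ha : IsAttractingPeriodicPt (expMap κ) n a)
    (hleft : ∃ R : ℝ, {z : ℂ | z.re < R} ⊆ immediateBasin (expMap κ) a)
    (κ₀ w : ℂ)
    (hw : expMap κ₀ w = w)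
    (hmult : multiplier (expMap κ₀) 1 w = multiplier (expMap κ) n a)
    (Ψ : ℂ → ℂ)
    (hΨ : IsConformalConjugacy Ψ ((expMap κ)^[n]) (expMap κ₀)
      (immediateBasin (expMap κ) a) (fatouSet (expMap κ₀))) :
    ¬ ∃ Φ : ℂ → ℂ,
        ContinuousOn Φ (closure (immediateBasin (expMap κ) a)) ∧
        Set.EqOn Φ Ψ (immediateBasin (expMap κ) a) := by
  rintro ⟨Φ, hΦ, hΦΨ⟩
  obtain ⟨R, hR⟩ := hleft
  obtain ⟨Y, C, hC, hpre⟩ := exists_preimage_norm_le hn ha hR hΨ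
  obtain ⟨c, hc, htrans⟩ := exists_translation_of_conjugacy (by omega) hR hΨ
  obtain ⟨t₀, ht₀0, ht₀⟩ := exists_log_log_le hC (norm_nonneg κ₀)
  -- The only use of the extension: it bounds `Ψ` on the part of the basin in a compact disc.
  obtain ⟨P, hP⟩ := ((isCompact_closedBall (0 : ℂ) (4 * t₀)).inter_left
    (isClosed_closure (s := immediateBasin (expMap κ) a))).exists_bound_of_continuousOn
      (hΦ.mono Set.inter_subset_left)
  set b : ℂ := ⟨R - 1, Y⟩ with hb
  have hbA : b ∈ immediateBasin (expMap κ) a := hR (by simp [hb])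
  -- `N ≥ P` gives `G^[N] t₀ ≥ P`, hence `G^[N] P ≤ X`; the second bound absorbs the additive errors
  -- at the end.
  obtain ⟨N, hN⟩ := exists_nat_ge (max P (‖b‖ + 2 * Real.pi + ‖Ψ b‖))
  have hNP : P ≤ N := (le_max_left _ _).trans hN
  have hNb : ‖b‖ + 2 * Real.pi + ‖Ψ b‖ ≤ N := (le_max_right _ _).trans hN
  set G : ℝ → ℝ := fun t => Real.exp t + ‖κ₀‖ with hG
  have hGm : Monotone G := fun s t hst => by simpa [hG] using hst
  set X := G^[2 * N] t₀ with hX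
  have hpi := Real.pi_pos
  have hXN : (2 * N : ℕ) ≤ X := by
    have := add_nat_le_iterate_exp_add (norm_nonneg κ₀) t₀ (2 * N)
    linarith
  push_cast at hXN
  have hPX : G^[N] P ≤ X := by
    rw [hX, two_mul, Function.iterate_add_apply]
    refine hGm.iterate N (hNP.trans ?_)
    have := add_nat_le_iterate_exp_add (norm_nonneg κ₀) t₀ N
    linarith
  -- The largest `k` with `‖b‖ + 2πk ≤ 4 * X`. Then `‖Ψ b + k * c‖` is at least `4 * X` up to
  -- additive errors, against the upper bound `X`.
  set k : ℕ := ⌊(4 * X - ‖b‖) / (2 * Real.pi)⌋₊ with hk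
  have hq : 0 ≤ (4 * X - ‖b‖) / (2 * Real.pi) :=
    div_nonneg (by linarith [norm_nonneg (Ψ b)]) (by positivity)
  have hk1 : k * (2 * Real.pi) ≤ 4 * X - ‖b‖ :=
    (le_div_iff₀ (by positivity)).1 (Nat.floor_le hq)
  have hk2 : 4 * X - ‖b‖ < (k + 1) * (2 * Real.pi) :=
    (div_lt_iff₀ (by positivity)).1 (Nat.lt_floor_add_one _)
  have hnorm : ‖2 * Real.pi * Complex.I * ((k : ℤ) : ℂ)‖ = k * (2 * Real.pi) := by
    simp [abs_of_pos hpi, mul_comm]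
  obtain ⟨z, hz, hzt, hzΨ⟩ := exists_norm_le_iterate_of_conjugacy hΨ.2.2 hC hpre ht₀ N
    (add_two_pi_mul_int_mem_immediateBasin hR hbA (k : ℤ)) (by simp [hb]; positivity)
    ((norm_add_le _ _).trans (by rw [hnorm]; linarith))
  have hzP : ‖Ψ z‖ ≤ P := by
    rw [← hΦΨ hz]
    exact hP z ⟨subset_closure hz, mem_closedBall_zero_iff.2 hzt⟩
  have hupper := (hzΨ.trans (hGm.iterate N hzP)).trans hPX
  rw [htrans b hbA k] at hupper
  have hlower : k * (2 * Real.pi) - ‖Ψ b‖ ≤ ‖Ψ b + k * c‖ := by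
    have h1 := norm_sub_norm_le (k * c) (-Ψ b)
    rw [norm_neg, sub_neg_eq_add, add_comm (_ * c), norm_mul, Complex.norm_natCast] at h1
    have h2 : (k : ℝ) * (2 * Real.pi) ≤ k * ‖c‖ := by gcongr
    linarith
  linarith [norm_nonneg b, norm_nonneg (Ψ b)]
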